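/- Small-period asymptotics. Let $V:\mathbb{R}\to\mathbb{R}$ be real-analytic in a neighbourhood of $0$ with $V'(0)=0$, $V''(0)=1$, and suppose that $V$ is softly anharmonic at small amplitude in the sense that $$A:=\frac{5\,V'''(0)^2}{48}-\frac{V''''(0)}{16}>0 .$$ Then there is $\varepsilon_0>0$ such that for every $\varepsilon\in(0,\varepsilon_0)$ the initial value problem $\ddot x+V'(x)=0$, $x(0)=\varepsilon$, $\dot x(0)=0$ has a unique solution $x$ on $\mathbb{R}$; it is even and periodic, and its least period $T(\varepsilon)$ satisfies $T(\varepsilon)>2\pi$. Let $z_1$ be the unique solution of $\ddot z_1+z_1=x$, $z_1(0)=\dot z_1(0)=0$. There is a unique even, $T(\varepsilon)$-periodic $C^2$ solution $\chi_1$ of $\ddot\chi_1+\chi_1=x$ (the component at the sites $\pm1$ of the tangent vector, at zero coupling, to the family of breathers continued from the one-site breather $x$), and $\chi_1(0)=z_1(T(\varepsilon))/(1-\cos T(\varepsilon))$. As $\varepsilon\to0^+$, $$T(\varepsilon)=2\pi\bigl(1+A\varepsilon^2+O(\varepsilon^3)\bigr),\qquad z_1(T(\varepsilon))=A\pi^2\varepsilon^3+O(\varepsilon^4),\qquad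 \chi_1(0)=\frac{1}{2A\varepsilon}+O(1).$$ Moreover, for a suitable $\varepsilon_0$, $\varepsilon\mapsto T(\varepsilon)$ is a strictly increasing bijection of $(0,\varepsilon_0)$ onto an interval $(2\pi,T_1)$, and, with $\chi_1(0)$ regarded in this way as a function of the period $T$, $\chi_1(0)\to+\infty$ as $T\to2\pi^+$. In particular, if for every $T>2\pi$ close to $2\pi$ there is exactly one even solution $x_T$ of $\ddot x+V'(x)=0$ with least period $T$ and $x_T(0)>0$ (of any amplitude), then $\chi_1(0)\to+\infty$ as $T\to2\pi^+$, where $\chi_1$ is the even $T$-periodic $C^2$ solution of $\ddot\chi_1+\chi_1=x_T$. -/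

import Mathlib

open Set Filter Topology Asymptotics

/-- `x` solves Newton's equation `x'' + V'(x) = 0` on the whole line. -/
structure IsNewtonSolution (V x : ℝ → ℝ) : Prop where
  differentiable : Differentiable ℝ x
  newton : ∀ t, HasDerivAt (deriv x) (-(deriv V (x t))) t

/-- `T` is the period (least positive period) of `x`. -/
def IsPeriodOf (x : ℝ → ℝ) (T : ℝ) : Prop :=
  IsLeast {S : ℝ | 0 < S ∧ Function.Periodic x S} T

/-- `x` is an oscillation `x_T` in the potential `V`: an even solution of Newton's equation
with period `T` and positive initial displacement. -/
structure IsOscillation (V : ℝ → ℝ) (T : ℝ) (x : ℝ → ℝ) : Prop where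
  solution : IsNewtonSolution V x
  period : IsPeriodOf x T
  even : Function.Even x
  pos : 0 < x 0

/-- `z` is the particular integral `z₁`: `z'' + z = x`, `z(0) = z'(0) = 0`. -/
structure IsParticularIntegral (x z : ℝ → ℝ) : Prop where
  differentiable : Differentiable ℝ z
  ode : ∀ t, HasDerivAt (deriv z) (x t - z t) t
  init : z 0 = 0
  init_deriv : deriv z 0 = 0

/-- `χ` is the off-central component `χ₁` of the tangent vector to the breather family:
an even, `T`-periodic, twice continuously differentiable function with `χ'' + χ = x`. -/
structure IsOffCentralComponent (T : ℝ) (x χ : ℝ → ℝ) : Prop where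
  contDiff : ContDiff ℝ 2 χ
  periodic : Function.Periodic χ T
  even : Function.Even χ
  ode : ∀ t, deriv (deriv χ) t + χ t = x t

/-- The coefficient `A` in `T(ε) = 2π (1 + A ε² + O(ε³))`. -/
noncomputable def periodCoefficient (V : ℝ → ℝ) : ℝ :=
  5 * (iteratedDeriv 3 V 0) ^ 2 / 48 - iteratedDeriv 4 V 0 / 16

/-- Two-term factorization of an analytic function at a critical point. -/
theorem AnalyticAt.exists_eq_add_sq_mul {f : ℝ → ℝ} (hf : AnalyticAt ℝ f 0)
    (hf1 : deriv f 0 = 0) :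
    ∃ w : ℝ → ℝ, AnalyticAt ℝ w 0 ∧ ∀ x, f x = f 0 + x ^ 2 * w x := by
  obtain ⟨p, hp⟩ := hf
  have h1 := hp.has_fpower_series_dslope_fslope
  have h2 := h1.has_fpower_series_dslope_fslope
  refine ⟨_, h2.analyticAt, fun x => ?_⟩
  have e1 := sub_smul_dslope f 0 x
  have e2 := sub_smul_dslope (dslope f 0) 0 x
  rw [dslope_same, hf1] at e2
  simp only [sub_zero, smul_eq_mul] at e1 e2
  rw [pow_two, mul_assoc, e2, e1]
  ring

theorem AnalyticAt.eventually_differentiableAt {f : ℝ → ℝ} {a : ℝ} (hf : AnalyticAt ℝ f a) :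
    ∀ᶠ x in 𝓝 a, DifferentiableAt ℝ f x :=
  hf.eventually_analyticAt.mono fun _ h => h.differentiableAt

theorem AnalyticAt.eventually_hasDerivAt {f : ℝ → ℝ} {a : ℝ} (hf : AnalyticAt ℝ f a) :
    ∀ᶠ x in 𝓝 a, HasDerivAt f (deriv f x) x :=
  hf.eventually_differentiableAt.mono fun _ h => h.hasDerivAt

/-- Near a nondegenerate minimum of the potential there is an analytic coordinate in which the
potential is exactly quadratic. -/
theorem exists_amplitude_chart {V : ℝ → ℝ} (hV : AnalyticAt ℝ V 0)
    (hV1 : deriv V 0 = 0) (hV2 : deriv (deriv V) 0 = 1) :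
    ∃ g : ℝ → ℝ, AnalyticAt ℝ g 0 ∧ g 0 = 0 ∧ 0 < deriv g 0 ∧
      ∀ᶠ s in 𝓝 0, V (g s) = V 0 + s ^ 2 / 2 := by
  obtain ⟨w, hw, hVw⟩ := hV.exists_eq_add_sq_mul hV1
  have hw0 : w 0 = 1 / 2 := by
    have e1 : deriv V =ᶠ[𝓝 0] fun x => 2 * x * w x + x ^ 2 * deriv w x := by
      filter_upwards [hw.eventually_hasDerivAt] with x hx
      have : HasDerivAt V (2 * x * w x + x ^ 2 * deriv w x) x := by
        rw [show V = fun x => V 0 + x ^ 2 * w x from funext hVw]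
        convert! (((hasDerivAt_id x).pow 2).mul hx).const_add _ using 1
        simp
      exact this.deriv
    have h1 := hw.differentiableAt.hasDerivAt
    have h2 := hw.deriv.differentiableAt.hasDerivAt
    have e2 : HasDerivAt (fun x => 2 * x * w x + x ^ 2 * deriv w x) (2 * w 0) 0 := by
      convert! (((hasDerivAt_id (0 : ℝ)).const_mul 2).mul h1).add
        (((hasDerivAt_id (0 : ℝ)).pow 2).mul h2) using 1
      simp
    rw [e1.deriv_eq, e2.deriv] at hV2
    linarith
  have hk : AnalyticAt ℝ (fun x => √(2 * w x)) 0 := by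
    refine ContDiffAt.analyticAt (ContDiffAt.sqrt ?_ (by rw [hw0]; norm_num))
    exact contDiffAt_const.mul hw.contDiffAt
  have hk0 : √(2 * w 0) = 1 := by rw [hw0]; norm_num
  set H : ℝ → ℝ := fun x => x * √(2 * w x) with hH
  have hHa : AnalyticAt ℝ H 0 := analyticAt_id.mul hk
  have hHd : HasDerivAt H 1 0 := by
    convert! (hasDerivAt_id (0 : ℝ)).mul hk.differentiableAt.hasDerivAt using 1
    simp [hk0]
  have hHc : ContDiffAt ℝ ⊤ H 0 := hHa.contDiffAt
  have hHs : HasStrictDerivAt H 1 0 := hHc.hasStrictDerivAt' hHd (by simp)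
  have hH0 : H 0 = 0 := by simp [hH]
  have hE := hHd.hasFDerivAt_equiv one_ne_zero
  have hgc := hHc.to_localInverse hE (by simp)
  set g := hHc.localInverse hE (by simp) with hg
  have hgi : ∀ᶠ s in 𝓝 (H 0), H (g s) = s :=
    (hHc.hasStrictFDerivAt' hE (by simp)).eventually_right_inverse
  have hg0 : g (H 0) = 0 := hHc.localInverse_apply_image hE (by simp)
  rw [hH0] at hgc hgi hg0
  have hga : AnalyticAt ℝ g 0 := hgc.analyticAt
  have hgd := hga.differentiableAt.hasDerivAt
  refine ⟨g, hga, hg0, ?_, ?_⟩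
  · have h1 : HasDerivAt (fun s => H (g s)) (1 * deriv g 0) 0 := by
      refine HasDerivAt.comp (h := g) (h₂ := H) (0 : ℝ) ?_ hgd
      rw [hg0]; exact hHd
    have h2 : HasDerivAt (fun s => H (g s)) 1 0 :=
      (hasDerivAt_id (0 : ℝ)).congr_of_eventuallyEq hgi
    have := h1.unique h2
    linarith
  · have hpos : ∀ᶠ x in 𝓝 (0 : ℝ), 0 < w x :=
      hw.continuousAt.eventually_const_lt (by rw [hw0]; norm_num)
    have hgt : Tendsto g (𝓝 0) (𝓝 0) := by simpa [hg0] using hga.continuousAt.tendsto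
    filter_upwards [hgi, hgt.eventually hpos] with s hs hp
    rw [hVw (g s)]
    have : (H (g s)) ^ 2 = (g s) ^ 2 * (2 * w (g s)) := by
      simp only [hH]
      rw [mul_pow, Real.sq_sqrt (by linarith)]
    rw [hs] at this
    linarith

/-- The Taylor coefficients of the amplitude chart. -/
theorem amplitude_chart_derivs {V g : ℝ → ℝ} (hV : AnalyticAt ℝ V 0)
    (hV1 : deriv V 0 = 0) (hV2 : deriv (deriv V) 0 = 1) (hg : AnalyticAt ℝ g 0) (hg0 : g 0 = 0)
    (hgp : 0 < deriv g 0) (hVg : ∀ᶠ s in 𝓝 0, V (g s) = V 0 + s ^ 2 / 2) :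
    (∀ᶠ s in 𝓝 0, deriv V (g s) * deriv g s = s) ∧ deriv g 0 = 1 ∧
      deriv (deriv (deriv g)) 0 = 4 * periodCoefficient V := by
  have hgt : Tendsto g (𝓝 0) (𝓝 0) := by simpa [hg0] using hg.continuousAt.tendsto
  have key : ∀ {F G : ℝ → ℝ} {F' G' : ℝ → ℝ}, (∀ᶠ s in 𝓝 0, F s = G s) →
      (∀ᶠ s in 𝓝 0, HasDerivAt F (F' s) s) → (∀ᶠ s in 𝓝 0, HasDerivAt G (G' s) s) →
      ∀ᶠ s in 𝓝 (0 : ℝ), F' s = G' s := by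
    intro F G F' G' h hF hG
    filter_upwards [h.eventually_nhds, hF, hG] with s h1 h2 h3
    exact (h2.congr_of_eventuallyEq (h1.mono fun _ h => h.symm)).unique h3
  have cV : ∀ {W : ℝ → ℝ}, AnalyticAt ℝ W 0 →
      ∀ᶠ s in 𝓝 0, HasDerivAt (fun s => W (g s)) (deriv W (g s) * deriv g s) s := by
    intro W hW
    filter_upwards [hgt.eventually hW.eventually_hasDerivAt, hg.eventually_hasDerivAt]
      with s h1 h2
    exact h1.comp s h2
  have v1 := cV hV
  have v2 := cV hV.deriv
  have v3 := cV hV.deriv.deriv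
  have v4 := cV hV.deriv.deriv.deriv
  have g2 := hg.deriv.eventually_hasDerivAt
  have g3 := hg.deriv.deriv.eventually_hasDerivAt
  have e1 := key (G' := fun s => s) hVg v1 (Eventually.of_forall fun s => by
    convert! (((hasDerivAt_id s).pow 2).div_const 2).const_add (V 0) using 1
    simp)
  have e2 := key (G' := fun _ => 1) e1 (by
    filter_upwards [v2, g2] with s h2 k2
    exact h2.mul k2) (Eventually.of_forall fun s => hasDerivAt_id s)
  have e3 := key (G' := fun _ => 0) e2 (by
    filter_upwards [v2, v3, g2, g3] with s h2 h3 k2 k3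
    exact ((h3.mul k2).mul k2).add (h2.mul k3)) (Eventually.of_forall fun s => hasDerivAt_const s _)
  have e4 := key (G' := fun _ => 0) e3 (by
    filter_upwards [v2, v3, v4, g2, g3, hg.deriv.deriv.deriv.eventually_hasDerivAt]
      with s h2 h3 h4 k2 k3 k4
    exact ((((((h4.mul k2).mul k2).add (h3.mul k3)).mul k2).add ((h3.mul k2).mul k3)).add
      (((h3.mul k2).mul k3).add (h2.mul k4)))) (Eventually.of_forall fun s => hasDerivAt_const s _)
  have f2 := e2.self_of_nhds
  have f3 := e3.self_of_nhds
  have f4 := e4.self_of_nhds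
  simp only [Pi.mul_apply, Pi.add_apply, hg0] at f2 f3 f4
  rw [hV1, hV2] at f2 f3 f4
  have d1 : deriv g 0 = 1 := by nlinarith
  refine ⟨e1, d1, ?_⟩
  rw [d1] at f3 f4
  simp only [periodCoefficient, iteratedDeriv_succ, iteratedDeriv_zero]
  have d2 : deriv (deriv g) 0 = - deriv (deriv (deriv V)) 0 / 3 := by linarith
  rw [d2] at f4
  linarith

theorem abs_sub_le_of_hasDerivAt {F F' : ℝ → ℝ} {ρ K : ℝ}
    (hF : ∀ s, |s| ≤ ρ → HasDerivAt F (F' s) s) (hK : ∀ s, |s| ≤ ρ → |F' s| ≤ K)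
    {s t : ℝ} (hs : |s| ≤ ρ) (ht : |t| ≤ ρ) : |F s - F t| ≤ K * |s - t| := by
  have := (convex_Icc (-ρ) ρ).norm_image_sub_le_of_norm_hasDerivWithin_le (f := F) (f' := F')
    (C := K) (fun x hx => (hF x (abs_le.2 hx)).hasDerivWithinAt) (fun x hx => hK x (abs_le.2 hx))
    (abs_le.1 ht) (abs_le.1 hs)
  simpa [Real.norm_eq_abs] using this

theorem abs_le_pow_succ_of_hasDerivAt {F F' : ℝ → ℝ} {R C : ℝ} {n : ℕ} (hC : 0 ≤ C)
    (hF : ∀ s, |s| < R → HasDerivAt F (F' s) s) (hK : ∀ s, |s| < R → |F' s| ≤ C * |s| ^ n)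
    (h0 : F 0 = 0) (s : ℝ) (hs : |s| < R) : |F s| ≤ C * |s| ^ (n + 1) := by
  have := abs_sub_le_of_hasDerivAt (ρ := |s|) (K := C * |s| ^ n)
    (fun t ht => hF t (ht.trans_lt hs)) (fun t ht => (hK t (ht.trans_lt hs)).trans (by gcongr))
    le_rfl (t := 0) (by simp)
  simpa [h0, pow_succ, mul_assoc] using this

/-- `g` is, on `(-R, R)`, a coordinate in which `V` is `V 0 + s ^ 2 / 2`, with quantitative
control of its Taylor expansion. -/
structure IsAmplitudeChart (V g : ℝ → ℝ) (R C a : ℝ) : Prop where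
  radius_pos : 0 < R
  const_pos : 0 < C
  map_zero : g 0 = 0
  hasDerivAt : ∀ s, |s| < R → HasDerivAt g (deriv g s) s
  continuousAt_deriv : ∀ s, |s| < R → ContinuousAt (deriv g) s
  le_deriv : ∀ s, |s| < R → 1 / 2 ≤ deriv g s
  force : ∀ s, |s| < R → deriv V (g s) * deriv g s = s
  regular : ∀ s, |s| < R → ContDiffAt ℝ 1 (deriv V) (g s)
  deriv_sub_one : ∀ s, |s| < R → |deriv g s - 1| ≤ C * |s|
  sub_self : ∀ s, |s| < R → |g s - s| ≤ C * s ^ 2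
  remainder : ∀ ρ < R, ∀ s t, |s| ≤ ρ → |t| ≤ ρ →
    |(deriv g s - a * s - 2 * periodCoefficient V * s ^ 2) -
      (deriv g t - a * t - 2 * periodCoefficient V * t ^ 2)| ≤ C * ρ ^ 2 * |s - t|

theorem exists_isAmplitudeChart {V : ℝ → ℝ} (hV : AnalyticAt ℝ V 0)
    (hV1 : deriv V 0 = 0) (hV2 : deriv (deriv V) 0 = 1) :
    ∃ (g : ℝ → ℝ) (R C a : ℝ), IsAmplitudeChart V g R C a := by
  obtain ⟨g, hg, hg0, hgp, hVg⟩ := exists_amplitude_chart hV hV1 hV2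
  obtain ⟨e1, d1, d3⟩ := amplitude_chart_derivs hV hV1 hV2 hg hg0 hgp hVg
  have hgt : Tendsto g (𝓝 0) (𝓝 0) := by simpa [hg0] using hg.continuousAt.tendsto
  set g2 := deriv (deriv g) with hg2
  set A := periodCoefficient V with hA
  set C₁ := |deriv (deriv g2) 0| + 1 with hC₁
  set C₂ := |g2 0| + 1 with hC₂
  have b4 : ∀ᶠ s in 𝓝 0, |deriv (deriv g2) s| < C₁ :=
    hg.deriv.deriv.deriv.deriv.continuousAt.abs.eventually_lt_const (lt_add_one _)
  have b2 : ∀ᶠ s in 𝓝 0, |g2 s| < C₂ :=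
    hg.deriv.deriv.continuousAt.abs.eventually_lt_const (lt_add_one _)
  have bl : ∀ᶠ s in 𝓝 0, 1 / 2 < deriv g s :=
    hg.deriv.continuousAt.eventually_const_lt (by rw [d1]; norm_num)
  have all := (((hg.eventually_analyticAt.and e1).and (b4.and b2)).and
    (bl.and (hgt.eventually hV.eventually_analyticAt)))
  obtain ⟨R, hR, hall⟩ := Metric.eventually_nhds_iff.1 all
  simp only [Real.dist_eq, sub_zero] at hall
  have hC₁p : 0 < C₁ := by positivity
  have hC₂p : 0 < C₂ := by positivity
  have hana : ∀ s, |s| < R → AnalyticAt ℝ g s := fun s hs => (hall hs).1.1.1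
  have r3 : ∀ s, |s| < R → |deriv g2 s - 4 * A| ≤ C₁ * |s| ^ 1 := fun s hs =>
    abs_le_pow_succ_of_hasDerivAt (F := fun s => deriv g2 s - 4 * A) (F' := deriv (deriv g2))
      (n := 0) hC₁p.le
      (fun s hs => (hana s hs).deriv.deriv.deriv.differentiableAt.hasDerivAt.sub_const _)
      (fun s hs => by simpa using (hall hs).1.2.1.le) (by simp [d3]) s hs
  have r2 : ∀ s, |s| < R → |g2 s - g2 0 - 4 * A * s| ≤ C₁ * |s| ^ 2 := fun s hs =>
    abs_le_pow_succ_of_hasDerivAt (F := fun s => g2 s - g2 0 - 4 * A * s)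
      (F' := fun s => deriv g2 s - 4 * A) (n := 1) hC₁p.le
      (fun s hs => by
        convert! ((hana s hs).deriv.deriv.differentiableAt.hasDerivAt.sub_const (g2 0)).sub
          ((hasDerivAt_id s).const_mul (4 * A)) using 1
        simp [hg2]) r3 (by simp) s hs
  have s1 : ∀ s, |s| < R → |deriv g s - 1| ≤ C₂ * |s| ^ 1 := fun s hs =>
    abs_le_pow_succ_of_hasDerivAt (F := fun s => deriv g s - 1) (F' := g2)
      (n := 0) hC₂p.le
      (fun s hs => (hana s hs).deriv.differentiableAt.hasDerivAt.sub_const _)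
      (fun s hs => by simpa using (hall hs).1.2.2.le) (by simp [d1]) s hs
  have s0 : ∀ s, |s| < R → |g s - s| ≤ C₂ * |s| ^ 2 := fun s hs =>
    abs_le_pow_succ_of_hasDerivAt (F := fun s => g s - s)
      (F' := fun s => deriv g s - 1) (n := 1) hC₂p.le
      (fun s hs => (hana s hs).differentiableAt.hasDerivAt.sub (hasDerivAt_id s)) s1
      (by simp [hg0]) s hs
  refine ⟨g, R, C₁ + C₂, g2 0, hR, by positivity, hg0,
    fun s hs => (hana s hs).differentiableAt.hasDerivAt,
    fun s hs => (hana s hs).deriv.continuousAt, fun s hs => (hall hs).2.1.le,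
    fun s hs => (hall hs).1.1.2, fun s hs => (hall hs).2.2.deriv.contDiffAt,
    fun s hs => ?_, fun s hs => ?_, fun ρ hρ s t hs ht => ?_⟩
  · have := s1 s hs
    rw [pow_one] at this
    nlinarith [abs_nonneg s]
  · have := s0 s hs
    rw [sq_abs] at this
    nlinarith [sq_nonneg s]
  · refine abs_sub_le_of_hasDerivAt (ρ := ρ)
      (F := fun s => deriv g s - g2 0 * s - 2 * A * s ^ 2)
      (F' := fun s => g2 s - g2 0 - 4 * A * s) (fun u hu => ?_) (fun u hu => ?_) hs ht
    · convert! ((hana u (hu.trans_lt hρ)).deriv.differentiableAt.hasDerivAt.sub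
        ((hasDerivAt_id u).const_mul (g2 0))).sub
          (((hasDerivAt_id u).pow 2).const_mul (2 * A)) using 1
      simp [hg2]
      ring
    · refine (r2 u (hu.trans_lt hρ)).trans ?_
      gcongr
      linarith

/-- Inverting the primitive of a positive, even, `2π`-periodic speed function. -/
theorem exists_phase {p : ℝ → ℝ} (hp : Continuous p) {m : ℝ} (hm : 0 < m) (hmp : ∀ φ, m ≤ p φ)
    (heven : Function.Even p) (hper : Function.Periodic p (2 * Real.pi)) :
    ∃ θ : ℝ → ℝ, (∀ t, HasDerivAt θ (p (θ t))⁻¹ t) ∧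
      (∀ φ, θ (∫ u in (0 : ℝ)..φ, p u) = φ) ∧ (∀ t, ∫ u in (0 : ℝ)..θ t, p u = t) ∧
      (∀ t, θ (-t) = -θ t) ∧
      ∀ t, θ (t + ∫ u in (0 : ℝ)..2 * Real.pi, p u) = θ t + 2 * Real.pi := by
  set τ : ℝ → ℝ := fun φ => ∫ u in (0 : ℝ)..φ, p u with hτ
  have hd : ∀ φ, HasDerivAt τ (p φ) φ := fun φ =>
    intervalIntegral.integral_hasDerivAt_right (hp.intervalIntegrable _ _)
      (hp.stronglyMeasurableAtFilter _ _) hp.continuousAt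
  have hmono : StrictMono τ := strictMono_of_deriv_pos fun φ => by
    rw [(hd φ).deriv]; exact hm.trans_le (hmp φ)
  have hcont : Continuous τ := continuous_iff_continuousAt.2 fun φ => (hd φ).continuousAt
  have hτ0 : τ 0 = 0 := by simp [hτ]
  have hlow : ∀ a b, a ≤ b → m * (b - a) ≤ τ b - τ a := fun a b hab => by
    have : τ b - τ a = ∫ u in a..b, p u := by
      rw [hτ]; exact intervalIntegral.integral_interval_sub_left
        (hp.intervalIntegrable _ _) (hp.intervalIntegrable _ _)
    rw [this]
    have h := intervalIntegral.integral_mono_on (μ := MeasureTheory.volume) (f := fun _ => m) hab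
      intervalIntegrable_const (hp.intervalIntegrable a b) (fun x _ => hmp x)
    simpa [mul_comm] using h
  have hsurj : Function.Surjective τ := by
    refine hcont.surjective ?_ ?_
    · refine tendsto_atTop_mono' _ ?_ (tendsto_id.const_mul_atTop hm)
      filter_upwards [eventually_ge_atTop 0] with φ hφ
      have := hlow 0 φ hφ
      rw [hτ0] at this
      simpa using this
    · refine tendsto_atBot_mono' _ ?_ (tendsto_id.const_mul_atBot hm)
      filter_upwards [eventually_le_atBot 0] with φ hφ
      have := hlow φ 0 hφ
      rw [hτ0] at this
      simp only [id]
      linarith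
  set e := hmono.orderIsoOfSurjective τ hsurj with he
  have heτ : ∀ φ, e φ = τ φ := fun φ => rfl
  have hr : ∀ t, τ (e.symm t) = t := fun t => e.apply_symm_apply t
  have hl : ∀ φ, e.symm (τ φ) = φ := fun φ => e.symm_apply_apply φ
  refine ⟨e.symm, fun t => ?_, hl, hr, fun t => ?_, fun t => ?_⟩
  · exact HasDerivAt.of_local_left_inverse e.symm.continuous.continuousAt (hd _)
      (hm.trans_le (hmp _)).ne' (Eventually.of_forall hr)
  · apply hmono.injective
    have : τ (-(e.symm t)) = -τ (e.symm t) := by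
      have h := intervalIntegral.integral_comp_neg (a := 0) (b := e.symm t) p
      simp only [heven _, neg_zero] at h
      simp only [hτ]
      rw [intervalIntegral.integral_symm, ← h]
    rw [hr, this, hr]
  · apply hmono.injective
    rw [hr]
    have h1 : τ (e.symm t + 2 * Real.pi) =
        τ (e.symm t) + ∫ u in (e.symm t)..(e.symm t + 2 * Real.pi), p u :=
      (intervalIntegral.integral_add_adjacent_intervals (hp.intervalIntegrable _ _)
        (hp.intervalIntegrable _ _)).symm
    rw [h1, hr, hper.intervalIntegral_add_eq _ 0, zero_add]

theorem abs_mul_cos_le {r : ℝ} (hr : 0 ≤ r) (φ : ℝ) : |r * Real.cos φ| ≤ r := by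
  rw [abs_mul, abs_of_nonneg hr]
  exact mul_le_of_le_one_right hr (Real.abs_cos_le_one φ)

theorem IsAmplitudeChart.continuous_deriv_comp {V g : ℝ → ℝ} {R C a r : ℝ}
    (h : IsAmplitudeChart V g R C a) (hr : 0 ≤ r) (hrR : r < R) :
    Continuous fun φ => deriv g (r * Real.cos φ) :=
  continuous_iff_continuousAt.2 fun φ =>
    ContinuousAt.comp (g := deriv g) (f := fun φ => r * Real.cos φ)
      (h.continuousAt_deriv _ ((abs_mul_cos_le hr φ).trans_lt hrR)) (by fun_prop)

/-- The period of the oscillation whose amplitude is `r` in the chart `g`. -/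
noncomputable def chartPeriod (g : ℝ → ℝ) (r : ℝ) : ℝ :=
  ∫ φ in (0 : ℝ)..2 * Real.pi, deriv g (r * Real.cos φ)

theorem IsAmplitudeChart.strictMonoOn {V g : ℝ → ℝ} {R C a : ℝ}
    (h : IsAmplitudeChart V g R C a) : StrictMonoOn g (Ioo (-R) R) := by
  have hd : ∀ s ∈ Ioo (-R) R, HasDerivAt g (deriv g s) s := fun s hs => h.hasDerivAt s (abs_lt.2 hs)
  refine strictMonoOn_of_deriv_pos (convex_Ioo _ _)
    (fun s hs => (hd s hs).continuousAt.continuousWithinAt) fun s hs => ?_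
  rw [interior_Ioo] at hs
  linarith [h.le_deriv s (abs_lt.2 hs)]

/-- The oscillation of chart amplitude `r`. -/
theorem IsAmplitudeChart.exists_oscillation {V g : ℝ → ℝ} {R C a r : ℝ}
    (h : IsAmplitudeChart V g R C a) (hr : 0 < r) (hrR : r < R) (hC : C * r ≤ 1 / 2) :
    ∃ x : ℝ → ℝ, IsNewtonSolution V x ∧ x 0 = g r ∧ deriv x 0 = 0 ∧
      IsOscillation V (chartPeriod g r) x ∧
      (∀ t, ContDiffAt ℝ 1 (deriv V) (x t)) ∧
      ∀ t, 0 ≤ t → t ≤ 4 * Real.pi → |x t - r * Real.cos t| ≤ (1 + 8 * Real.pi) * C * r ^ 2 := by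
  have hlt : ∀ φ, |r * Real.cos φ| < R := fun φ => (abs_mul_cos_le hr.le φ).trans_lt hrR
  set p : ℝ → ℝ := fun φ => deriv g (r * Real.cos φ) with hp
  have hpc : Continuous p := h.continuous_deriv_comp hr.le hrR
  have hp2 : ∀ φ, 1 / 2 ≤ p φ := fun φ => h.le_deriv _ (hlt φ)
  obtain ⟨θ, hθ, hθτ, hτθ, hodd, hadd⟩ := exists_phase hpc (by norm_num) hp2
    (fun φ => by simp [hp]) (fun φ => by simp [hp])
  have hT : ∫ u in (0 : ℝ)..2 * Real.pi, p u = chartPeriod g r := rfl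
  rw [hT] at hadd
  have hθ0 : θ 0 = 0 := by simpa using hθτ 0
  have hx : ∀ t, HasDerivAt (fun t => g (r * Real.cos (θ t))) (-(r * Real.sin (θ t))) t := by
    intro t
    have h1 : HasDerivAt (fun t => r * Real.cos (θ t))
        (r * (-Real.sin (θ t) * (p (θ t))⁻¹)) t := (hθ t).cos.const_mul r
    have h2 := (h.hasDerivAt _ (hlt (θ t))).comp t h1
    convert! h2 using 1
    have : deriv g (r * Real.cos (θ t)) ≠ 0 := by have := hp2 (θ t); simp only [hp] at this; linarith
    simp only [hp]
    field_simp
  have hdx : deriv (fun t => g (r * Real.cos (θ t))) = fun t => -(r * Real.sin (θ t)) :=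
    funext fun t => (hx t).deriv
  have hsol : IsNewtonSolution V fun t => g (r * Real.cos (θ t)) := by
    refine ⟨fun t => (hx t).differentiableAt, fun t => ?_⟩
    rw [hdx]
    convert! ((hθ t).sin.const_mul r).neg using 1
    have h0 : deriv g (r * Real.cos (θ t)) ≠ 0 := by
      have := hp2 (θ t); simp only [hp] at this; linarith
    have hf := h.force _ (hlt (θ t))
    simp only [hp]
    rw [← mul_assoc, (eq_mul_inv_iff_mul_eq₀ h0).2 hf]
  have hTpos : 0 < chartPeriod g r := by
    have := intervalIntegral.integral_mono_on (μ := MeasureTheory.volume) (f := fun _ => (1 / 2 : ℝ)) (a := 0)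
      (b := 2 * Real.pi) (by positivity) intervalIntegrable_const (hpc.intervalIntegrable _ _)
      (fun x _ => hp2 x)
    rw [hT] at this
    simp at this
    linarith [Real.pi_pos]
  have hper : Function.Periodic (fun t => g (r * Real.cos (θ t))) (chartPeriod g r) := by
    intro t
    simp only [hadd, Real.cos_add_two_pi]
  have hgr : 0 < g r := by
    have : g 0 < g r := h.strictMonoOn ⟨by linarith, by linarith⟩ ⟨by linarith, hrR⟩ hr
    rwa [h.map_zero] at this
  refine ⟨fun t => g (r * Real.cos (θ t)), hsol, by simp [hθ0], by simp [hdx, hθ0],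
    ⟨hsol, ⟨⟨hTpos, hper⟩, ?_⟩, fun t => by simp [hodd], by simpa [hθ0] using hgr⟩,
    fun t => h.regular _ (hlt _), ?_⟩
  · rintro S ⟨hS, hSper⟩
    have h1 : g (r * Real.cos (θ S)) = g r := by simpa [hθ0] using hSper 0
    have h2 : r * Real.cos (θ S) = r := h.strictMonoOn.injOn (abs_lt.1 (hlt _))
      ⟨by linarith, hrR⟩ h1
    have h3 : Real.cos (θ S) = 1 := mul_left_cancel₀ hr.ne' (by simpa using h2)
    obtain ⟨k, hk⟩ := (Real.cos_eq_one_iff _).1 h3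
    have hmono : StrictMono θ := strictMono_of_deriv_pos fun t => by
      rw [(hθ t).deriv]; exact inv_pos.2 (by linarith [hp2 (θ t)])
    have hSp : 0 < θ S := by rw [← hθ0]; exact hmono hS
    have hk1 : 1 ≤ k := by
      rw [← hk] at hSp
      have : (0 : ℝ) < k := by
        by_contra hcon
        push Not at hcon
        nlinarith [Real.pi_pos]
      exact_mod_cast this
    have hk1' : (1 : ℝ) ≤ k := by exact_mod_cast hk1
    rw [← hmono.le_iff_le, ← hk]
    have := hadd 0
    rw [hθ0, zero_add, zero_add] at this
    rw [this]
    nlinarith [Real.pi_pos]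
  · intro t ht0 ht4
    have hmono : StrictMono θ := strictMono_of_deriv_pos fun t => by
      rw [(hθ t).deriv]; exact inv_pos.2 (by linarith [hp2 (θ t)])
    have hθt0 : 0 ≤ θ t := by rw [← hθ0]; exact hmono.monotone ht0
    have hp1 : ∀ φ, |p φ - 1| ≤ C * r := fun φ => (h.deriv_sub_one _ (hlt φ)).trans
      (by gcongr; exacts [h.const_pos.le, abs_mul_cos_le hr.le φ])
    have hτ1 : |t - θ t| ≤ C * r * θ t := by
      have h1 : t - θ t = ∫ u in (0 : ℝ)..θ t, (p u - 1) := by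
        rw [intervalIntegral.integral_sub (hpc.intervalIntegrable _ _) (by simp), hτθ]
        simp
      rw [h1]
      have := intervalIntegral.norm_integral_le_of_norm_le_const (a := 0) (b := θ t)
        (f := fun u => p u - 1) (C := C * r) (fun u _ => hp1 u)
      simpa [abs_of_nonneg hθt0] using this
    have hθ2 : θ t ≤ 8 * Real.pi := by
      have := (abs_le.1 hτ1).1
      have : C * r * θ t ≤ 1 / 2 * θ t := by gcongr
      linarith
    have hcos : |Real.cos (θ t) - Real.cos t| ≤ |t - θ t| := by
      have := Real.abs_cos_sub_cos_le (θ t) t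
      rwa [abs_sub_comm (θ t)] at this
    have h1 := h.sub_self _ (hlt (θ t))
    have h2 : (r * Real.cos (θ t)) ^ 2 ≤ r ^ 2 := by
      rw [← sq_abs]
      gcongr
      exact abs_mul_cos_le hr.le _
    have hC0 := h.const_pos
    have h3 : |r * Real.cos (θ t) - r * Real.cos t| ≤ r * (C * r * (8 * Real.pi)) := by
      rw [← mul_sub, abs_mul, abs_of_pos hr]
      gcongr
      refine hcos.trans (hτ1.trans ?_)
      gcongr
    calc |g (r * Real.cos (θ t)) - r * Real.cos t|
        ≤ |g (r * Real.cos (θ t)) - r * Real.cos (θ t)| + |r * Real.cos (θ t) - r * Real.cos t| :=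
          abs_sub_le _ _ _
      _ ≤ C * r ^ 2 + r * (C * r * (8 * Real.pi)) := by
          gcongr
          exact h1.trans (by gcongr)
      _ = _ := by ring

/-- A solution of the initial value problem that stays where the force is `C¹` is the only one. -/
theorem IsNewtonSolution.eq_of_init {V x y : ℝ → ℝ} (hx : IsNewtonSolution V x)
    (hreg : ∀ t, ContDiffAt ℝ 1 (deriv V) (x t)) (hy : IsNewtonSolution V y)
    (h0 : y 0 = x 0) (h1 : deriv y 0 = deriv x 0) : y = x := by
  have cdx : Continuous (deriv x) := continuous_iff_continuousAt.2 fun t => (hx.newton t).continuousAt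
  have cdy : Continuous (deriv y) := continuous_iff_continuousAt.2 fun t => (hy.newton t).continuousAt
  set X : ℝ → ℝ × ℝ := fun t => (x t, deriv x t) with hX
  set Y : ℝ → ℝ × ℝ := fun t => (y t, deriv y t) with hY
  have cX : Continuous X := hx.differentiable.continuous.prodMk cdx
  have cY : Continuous Y := hy.differentiable.continuous.prodMk cdy
  set v : ℝ × ℝ → ℝ × ℝ := fun q => (q.2, -deriv V q.1) with hv
  have dX : ∀ t, HasDerivAt X (v (X t)) t := fun t =>
    (hx.differentiable t).hasDerivAt.prodMk (hx.newton t)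
  have dY : ∀ t, HasDerivAt Y (v (Y t)) t := fun t =>
    (hy.differentiable t).hasDerivAt.prodMk (hy.newton t)
  have hcl : IsClosed {t | Y t = X t} := isClosed_eq cY cX
  have hop : IsOpen {t | Y t = X t} := by
    rw [isOpen_iff_mem_nhds]
    intro t₀ ht₀
    have ht₀ : Y t₀ = X t₀ := ht₀
    have hvc : ContDiffAt ℝ 1 v (X t₀) := by
      refine contDiffAt_snd.prodMk (ContDiffAt.neg ?_)
      exact ContDiffAt.comp (X t₀) (g := deriv V) (f := Prod.fst) (hreg t₀) contDiffAt_fst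
    obtain ⟨K, s, hs, hlip⟩ := hvc.exists_lipschitzOnWith
    exact ODE_solution_unique_of_eventually (v := fun _ => v) (s := fun _ => s)
      (Eventually.of_forall fun _ => hlip)
      ((cY.continuousAt.eventually_mem (by rwa [ht₀])).mono fun t ht => ⟨dY t, ht⟩)
      ((cX.continuousAt.eventually_mem hs).mono fun t ht => ⟨dX t, ht⟩) ht₀
  have huniv := IsClopen.eq_univ ⟨hcl, hop⟩ ⟨0, by simp [hX, hY, h0, h1]⟩
  funext t
  have ht : t ∈ {t | Y t = X t} := huniv ▸ mem_univ t
  exact congrArg Prod.fst ht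

/-- `u'' + u = x` on the whole line. -/
structure IsForcedOscillator (x u : ℝ → ℝ) : Prop where
  differentiable : Differentiable ℝ u
  ode : ∀ t, HasDerivAt (deriv u) (x t - u t) t

theorem IsForcedOscillator.sub_eq {x u w : ℝ → ℝ} (hu : IsForcedOscillator x u)
    (hw : IsForcedOscillator x w) (t : ℝ) :
    w t - u t = (w 0 - u 0) * Real.cos t + (deriv w 0 - deriv u 0) * Real.sin t := by
  set d := fun t => w t - u t with hd
  set e := fun t => deriv w t - deriv u t with he
  have h1 : ∀ t, HasDerivAt d (e t) t := fun t =>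
    (hw.differentiable t).hasDerivAt.sub (hu.differentiable t).hasDerivAt
  have h2 : ∀ t, HasDerivAt e (-d t) t := fun t => by
    convert! (hw.ode t).sub (hu.ode t) using 1
    simp only [hd]; ring
  have ha : ∀ t, HasDerivAt (fun t => d t * Real.cos t - e t * Real.sin t) 0 t := fun t => by
    convert! ((h1 t).mul (Real.hasDerivAt_cos t)).sub ((h2 t).mul (Real.hasDerivAt_sin t)) using 1
    ring
  have hb : ∀ t, HasDerivAt (fun t => d t * Real.sin t + e t * Real.cos t) 0 t := fun t => by
    convert! ((h1 t).mul (Real.hasDerivAt_sin t)).add ((h2 t).mul (Real.hasDerivAt_cos t)) using 1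
    ring
  have ea := is_const_of_deriv_eq_zero (fun t => (ha t).differentiableAt) (fun t => (ha t).deriv) t 0
  have eb := is_const_of_deriv_eq_zero (fun t => (hb t).differentiableAt) (fun t => (hb t).deriv) t 0
  simp only [Real.cos_zero, Real.sin_zero, mul_one, mul_zero, sub_zero, zero_add] at ea eb
  change d t = d 0 * Real.cos t + e 0 * Real.sin t
  rw [← ea, ← eb]
  linear_combination (-(d t)) * Real.sin_sq_add_cos_sq t

theorem IsParticularIntegral.isForcedOscillator {x z : ℝ → ℝ} (h : IsParticularIntegral x z) :
    IsForcedOscillator x z := ⟨h.differentiable, h.ode⟩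

theorem IsOffCentralComponent.isForcedOscillator {T : ℝ} {x χ : ℝ → ℝ}
    (h : IsOffCentralComponent T x χ) : IsForcedOscillator x χ := by
  refine ⟨h.contDiff.differentiable (by norm_num), fun t => ?_⟩
  have h2 : Differentiable ℝ (deriv χ) :=
    ((contDiff_succ_iff_deriv (n := 1)).1 h.contDiff).2.2.differentiable (by norm_num)
  rw [← h.ode t, add_sub_cancel_right]
  exact (h2 t).hasDerivAt

theorem IsParticularIntegral.unique {x z w : ℝ → ℝ} (hz : IsParticularIntegral x z)
    (hw : IsParticularIntegral x w) : w = z := by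
  funext t
  have := hz.isForcedOscillator.sub_eq hw.isForcedOscillator t
  rw [hz.init, hw.init, hz.init_deriv, hw.init_deriv] at this
  linarith

/-- Variation of constants. -/
theorem exists_isParticularIntegral {x : ℝ → ℝ} (hx : Continuous x) :
    ∃ z : ℝ → ℝ, IsParticularIntegral x z ∧ ∀ t, deriv z t =
      Real.cos t * (∫ s in (0 : ℝ)..t, Real.cos s * x s) +
        Real.sin t * ∫ s in (0 : ℝ)..t, Real.sin s * x s := by
  set P := fun t => ∫ s in (0 : ℝ)..t, Real.cos s * x s with hP
  set Q := fun t => ∫ s in (0 : ℝ)..t, Real.sin s * x s with hQ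
  have hd : ∀ {f : ℝ → ℝ}, Continuous f → ∀ t,
      HasDerivAt (fun t => ∫ s in (0 : ℝ)..t, f s) (f t) t := fun hf t =>
    intervalIntegral.integral_hasDerivAt_right (hf.intervalIntegrable _ _)
      (hf.stronglyMeasurableAtFilter _ _) hf.continuousAt
  have dP : ∀ t, HasDerivAt P (Real.cos t * x t) t := hd (Real.continuous_cos.mul hx)
  have dQ : ∀ t, HasDerivAt Q (Real.sin t * x t) t := hd (Real.continuous_sin.mul hx)
  have dz : ∀ t, HasDerivAt (fun t => Real.sin t * P t - Real.cos t * Q t)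
      (Real.cos t * P t + Real.sin t * Q t) t := fun t => by
    convert! ((Real.hasDerivAt_sin t).mul (dP t)).sub ((Real.hasDerivAt_cos t).mul (dQ t)) using 1
    ring
  have hdz : deriv (fun t => Real.sin t * P t - Real.cos t * Q t) =
      fun t => Real.cos t * P t + Real.sin t * Q t := funext fun t => (dz t).deriv
  refine ⟨_, ⟨fun t => (dz t).differentiableAt, fun t => ?_, by simp [hQ], ?_⟩,
    fun t => (dz t).deriv⟩
  · rw [hdz]
    convert! ((Real.hasDerivAt_cos t).mul (dP t)).add ((Real.hasDerivAt_sin t).mul (dQ t)) using 1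
    linear_combination (-(x t)) * Real.sin_sq_add_cos_sq t
  · rw [hdz]; simp [hP]

theorem IsForcedOscillator.comp_neg {x u : ℝ → ℝ} (hx : Function.Even x)
    (h : IsForcedOscillator x u) : IsForcedOscillator x fun t => u (-t) := by
  have h1 : ∀ t, HasDerivAt (fun t => u (-t)) (-deriv u (-t)) t := fun t => by
    convert! (h.differentiable (-t)).hasDerivAt.scomp t (hasDerivAt_neg t) using 1
    simp
  refine ⟨fun t => (h1 t).differentiableAt, fun t => ?_⟩
  rw [show deriv (fun t => u (-t)) = fun t => -deriv u (-t) from funext fun t => (h1 t).deriv]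
  convert! ((h.ode (-t)).scomp t (hasDerivAt_neg t)).neg using 1
  simp [hx t]

theorem IsForcedOscillator.comp_add {x u : ℝ → ℝ} {T : ℝ} (hx : Function.Periodic x T)
    (h : IsForcedOscillator x u) : IsForcedOscillator x fun t => u (t + T) := by
  have h1 : ∀ t, HasDerivAt (fun t => u (t + T)) (deriv u (t + T)) t := fun t =>
    (h.differentiable (t + T)).hasDerivAt.comp_add_const t T
  refine ⟨fun t => (h1 t).differentiableAt, fun t => ?_⟩
  rw [show deriv (fun t => u (t + T)) = fun t => deriv u (t + T) from funext fun t => (h1 t).deriv]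
  simpa [hx t] using (h.ode (t + T)).comp_add_const t T

theorem IsParticularIntegral.even {x z : ℝ → ℝ} (hx : Function.Even x)
    (hz : IsParticularIntegral x z) : Function.Even z := by
  have h := hz.isForcedOscillator.comp_neg hx
  refine congrFun (hz.unique ⟨h.differentiable, h.ode, by simp [hz.init], ?_⟩)
  rw [deriv_comp_neg]
  simp [hz.init_deriv]

theorem cos_ne_one_of_sin_ne_zero {T : ℝ} (hT : Real.sin T ≠ 0) : 1 - Real.cos T ≠ 0 := by
  intro h
  apply hT
  have := Real.sin_sq_add_cos_sq T
  rw [show Real.cos T = 1 by linarith] at this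
  nlinarith

/-- The off-central component away from resonance. -/
theorem IsParticularIntegral.exists_isOffCentralComponent {x z : ℝ → ℝ} {T : ℝ}
    (hz : IsParticularIntegral x z) (hxc : Continuous x) (hxe : Function.Even x)
    (hxp : Function.Periodic x T) (hT : Real.sin T ≠ 0) :
    ∃ χ : ℝ → ℝ, IsOffCentralComponent T x χ ∧ χ 0 = z T / (1 - Real.cos T) ∧
      χ 0 * Real.sin T = deriv z T := by
  have hT1 := cos_ne_one_of_sin_ne_zero hT
  set c := z T / (1 - Real.cos T) with hc
  have dχ : ∀ t, HasDerivAt (fun t => z t + c * Real.cos t) (deriv z t - c * Real.sin t) t :=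
    fun t => by
      convert! (hz.differentiable t).hasDerivAt.add ((Real.hasDerivAt_cos t).const_mul c) using 1
      ring
  have hdχ : deriv (fun t => z t + c * Real.cos t) = fun t => deriv z t - c * Real.sin t :=
    funext fun t => (dχ t).deriv
  have ddχ : ∀ t, HasDerivAt (deriv fun t => z t + c * Real.cos t)
      (x t - (z t + c * Real.cos t)) t := fun t => by
    rw [hdχ]
    convert! (hz.ode t).sub ((Real.hasDerivAt_sin t).const_mul c) using 1
    ring
  have hF : IsForcedOscillator x fun t => z t + c * Real.cos t :=
    ⟨fun t => (dχ t).differentiableAt, ddχ⟩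
  have hper : Function.Periodic (fun t => z t + c * Real.cos t) T := by
    have h := hF.sub_eq (hF.comp_add hxp)
    have h0 : z T + c * Real.cos T = c := by
      rw [hc]; field_simp; ring
    have hm := h (-T)
    have hev := hz.even hxe T
    simp only [neg_add_cancel, zero_add, hz.init, Real.cos_zero, mul_one, Real.cos_neg, hev,
      Real.sin_neg, h0, sub_self, zero_mul] at hm h
    have hd : deriv (fun t => z (t + T) + c * Real.cos (t + T)) 0 -
        deriv (fun t => z t + c * Real.cos t) 0 = 0 := by
      by_contra hne
      exact mul_ne_zero hne (neg_ne_zero.2 hT) hm.symm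
    intro t
    have := h t
    rw [hd] at this
    simp only
    linarith
  have hχ0 : z 0 + c * Real.cos 0 = c := by simp [hz.init]
  refine ⟨fun t => z t + c * Real.cos t, ⟨?_, hper, fun t => by simp [hz.even hxe t], fun t => ?_⟩,
    hχ0, ?_⟩
  · rw [show (2 : WithTop ℕ∞) = 1 + 1 by norm_num, contDiff_succ_iff_deriv]
    refine ⟨hF.differentiable, by simp, ?_⟩
    rw [contDiff_one_iff_deriv]
    refine ⟨fun t => (ddχ t).differentiableAt, ?_⟩
    rw [funext fun t => (ddχ t).deriv]
    exact hxc.sub hF.differentiable.continuous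
  · rw [(ddχ t).deriv]; ring
  · simp only [hχ0]
    have h1 : deriv (fun t => z t + c * Real.cos t) T =
        deriv (fun t => z t + c * Real.cos t) 0 := by
      have := deriv_comp_add_const (fun t => z t + c * Real.cos t) T 0
      rw [zero_add] at this
      rw [← this]
      congr 1
      exact funext hper
    simp only [hdχ, hz.init_deriv, Real.sin_zero, mul_zero, sub_zero] at h1
    linarith

theorem IsOffCentralComponent.unique {T : ℝ} {x χ w : ℝ → ℝ} (hχ : IsOffCentralComponent T x χ)
    (hw : IsOffCentralComponent T x w) (hT : Real.sin T ≠ 0) : w = χ := by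
  have hT1 := cos_ne_one_of_sin_ne_zero hT
  have h := hχ.isForcedOscillator.sub_eq hw.isForcedOscillator
  have h1 := h (Real.pi / 2)
  have h2 := h (-(Real.pi / 2))
  rw [hw.even, hχ.even] at h2
  simp only [Real.cos_neg, Real.sin_neg, Real.cos_pi_div_two, Real.sin_pi_div_two] at h1 h2
  have hd : deriv w 0 - deriv χ 0 = 0 := by linarith
  have h3 := h T
  rw [hd, hw.periodic.eq, hχ.periodic.eq] at h3
  have h0 : (w 0 - χ 0) * (1 - Real.cos T) = 0 := by linarith
  have h0' := (mul_eq_zero.1 h0).resolve_right hT1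
  funext t
  have := h t
  rw [hd, h0'] at this
  linarith

theorem IsAmplitudeChart.abs_chartPeriod_sub_le {V g : ℝ → ℝ} {R C a ρ s t : ℝ}
    (h : IsAmplitudeChart V g R C a) (hs : 0 ≤ s) (hsρ : s ≤ ρ) (ht : 0 ≤ t) (htρ : t ≤ ρ)
    (hρ : ρ < R) :
    |chartPeriod g s - chartPeriod g t -
      2 * Real.pi * periodCoefficient V * (s ^ 2 - t ^ 2)| ≤
        2 * Real.pi * C * ρ ^ 2 * |s - t| := by
  set A := periodCoefficient V
  set k : ℝ → ℝ := fun y => deriv g y - a * y - 2 * A * y ^ 2 with hk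
  have cs := h.continuous_deriv_comp hs (hsρ.trans_lt hρ)
  have ct := h.continuous_deriv_comp ht (htρ.trans_lt hρ)
  have key : chartPeriod g s - chartPeriod g t - 2 * Real.pi * A * (s ^ 2 - t ^ 2) =
      ∫ φ in (0 : ℝ)..2 * Real.pi, (k (s * Real.cos φ) - k (t * Real.cos φ)) := by
    have e : (fun φ => k (s * Real.cos φ) - k (t * Real.cos φ)) = fun φ =>
        (deriv g (s * Real.cos φ) - deriv g (t * Real.cos φ)) -
          (a * (s - t) * Real.cos φ + 2 * A * (s ^ 2 - t ^ 2) * Real.cos φ ^ 2) := by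
      funext φ; simp only [hk]; ring
    have c1 : Continuous fun φ => a * (s - t) * Real.cos φ := by fun_prop
    have c2 : Continuous fun φ => 2 * A * (s ^ 2 - t ^ 2) * Real.cos φ ^ 2 := by fun_prop
    rw [e, intervalIntegral.integral_sub, intervalIntegral.integral_sub,
      intervalIntegral.integral_add,
      intervalIntegral.integral_const_mul, intervalIntegral.integral_const_mul, integral_cos,
      integral_cos_sq]
    rotate_left
    · exact c1.intervalIntegrable _ _
    · exact c2.intervalIntegrable _ _
    · exact cs.intervalIntegrable _ _
    · exact ct.intervalIntegrable _ _
    · exact (cs.sub ct).intervalIntegrable _ _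
    · exact (c1.add c2).intervalIntegrable _ _
    simp [chartPeriod]
    ring
  rw [key]
  have hρ0 : 0 ≤ ρ := hs.trans hsρ
  have := intervalIntegral.norm_integral_le_of_norm_le_const (a := 0) (b := 2 * Real.pi)
    (f := fun φ => k (s * Real.cos φ) - k (t * Real.cos φ)) (C := C * ρ ^ 2 * |s - t|)
    (fun φ _ => by
      refine (h.remainder ρ hρ _ _ ((abs_mul_cos_le hs φ).trans hsρ)
        ((abs_mul_cos_le ht φ).trans htρ)).trans ?_
      have hC := h.const_pos
      refine mul_le_mul_of_nonneg_left ?_ (by positivity)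
      rw [← sub_mul, abs_mul]
      exact mul_le_of_le_one_right (abs_nonneg _) (Real.abs_cos_le_one φ))
  rw [Real.norm_eq_abs, sub_zero, abs_of_pos Real.two_pi_pos] at this
  linarith

theorem IsAmplitudeChart.chartPeriod_zero {V g : ℝ → ℝ} {R C a : ℝ}
    (h : IsAmplitudeChart V g R C a) : chartPeriod g 0 = 2 * Real.pi := by
  have := h.deriv_sub_one 0 (by simpa using h.radius_pos)
  rw [abs_zero, mul_zero, abs_nonpos_iff, sub_eq_zero] at this
  simp [chartPeriod, this]

theorem IsAmplitudeChart.strictMonoOn_chartPeriod {V g : ℝ → ℝ} {R C a r₀ : ℝ}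
    (h : IsAmplitudeChart V g R C a) (hR : r₀ < R) (hA : C * r₀ < periodCoefficient V) :
    StrictMonoOn (chartPeriod g) (Icc 0 r₀) := by
  intro s hs t ht hst
  have h1 := (abs_le.1 (h.abs_chartPeriod_sub_le ht.1 le_rfl hs.1 hst.le (ht.2.trans_lt hR))).1
  rw [abs_of_pos (sub_pos.2 hst)] at h1
  have ht0 : 0 < t := hs.1.trans_lt hst
  have h2 : C * t < periodCoefficient V :=
    (mul_le_mul_of_nonneg_left ht.2 h.const_pos.le).trans_lt hA
  have h3 : 0 < 2 * Real.pi * (t - s) * (t * (periodCoefficient V - C * t)) := by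
    have : 0 < t - s := by linarith
    have : 0 < periodCoefficient V - C * t := by linarith
    positivity
  have hApos : 0 < periodCoefficient V := (mul_pos h.const_pos ht0).trans h2
  have h4 : 0 ≤ 2 * Real.pi * (t - s) * (periodCoefficient V * s) := by
    have : 0 < t - s := by linarith
    have := hs.1
    positivity
  nlinarith

theorem IsAmplitudeChart.continuousOn_chartPeriod {V g : ℝ → ℝ} {R C a r₀ : ℝ}
    (h : IsAmplitudeChart V g R C a) (hR : r₀ < R) :
    ContinuousOn (chartPeriod g) (Icc 0 r₀) := by
  intro t ht
  have hlim : Tendsto (fun s => 2 * Real.pi * periodCoefficient V * (s ^ 2 - t ^ 2) +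
      2 * Real.pi * C * r₀ ^ 2 * |s - t|) (𝓝[Icc 0 r₀] t) (𝓝 0) := by
    have : Continuous fun s => 2 * Real.pi * periodCoefficient V * (s ^ 2 - t ^ 2) +
      2 * Real.pi * C * r₀ ^ 2 * |s - t| := by fun_prop
    simpa using (this.tendsto t).mono_left nhdsWithin_le_nhds
  have hlim' : Tendsto (fun s => 2 * Real.pi * periodCoefficient V * (s ^ 2 - t ^ 2) -
      2 * Real.pi * C * r₀ ^ 2 * |s - t|) (𝓝[Icc 0 r₀] t) (𝓝 0) := by
    have : Continuous fun s => 2 * Real.pi * periodCoefficient V * (s ^ 2 - t ^ 2) -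
      2 * Real.pi * C * r₀ ^ 2 * |s - t| := by fun_prop
    simpa using (this.tendsto t).mono_left nhdsWithin_le_nhds
  have hmain : Tendsto (fun s => chartPeriod g s - chartPeriod g t) (𝓝[Icc 0 r₀] t) (𝓝 0) := by
    refine tendsto_of_tendsto_of_tendsto_of_le_of_le' hlim' hlim ?_ ?_ <;>
    · filter_upwards [self_mem_nhdsWithin] with s hs
      have := abs_le.1 (h.abs_chartPeriod_sub_le hs.1 hs.2 ht.1 ht.2 hR)
      linarith [this.1, this.2]
  exact tendsto_sub_nhds_zero_iff.1 hmain

/-- The first resonant Fourier integral of a nearly harmonic oscillation. -/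
theorem IsParticularIntegral.abs_deriv_sub_le {x z : ℝ → ℝ} {r K T : ℝ} (hxc : Continuous x)
    (hz : IsParticularIntegral x z) (hr : 0 ≤ r) (hr1 : r ≤ 1) (hK : 0 ≤ K)
    (hT : 2 * Real.pi ≤ T) (hT4 : T ≤ 4 * Real.pi)
    (hx : ∀ t, 0 ≤ t → t ≤ 4 * Real.pi → |x t - r * Real.cos t| ≤ K * r ^ 2) :
    |deriv z T - Real.pi * r| ≤ 4 * Real.pi * K * r ^ 2 +
      (1 + Real.pi + 4 * Real.pi * (1 + K)) * (T - 2 * Real.pi) := by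
  obtain ⟨w, hw, hdw⟩ := exists_isParticularIntegral hxc
  rw [← hz.unique hw, hdw]
  have hπ := Real.pi_pos
  set δ := T - 2 * Real.pi with hδ
  have hT0 : 0 ≤ T := by linarith
  have hδ0 : 0 ≤ δ := by linarith
  have hsin : |Real.sin T| ≤ δ := by
    have : Real.sin T = Real.sin δ := by rw [hδ, Real.sin_sub_two_pi]
    rw [this]
    exact Real.abs_sin_le_abs.trans (abs_of_nonneg hδ0).le
  have hP : |(∫ s in (0 : ℝ)..T, Real.cos s * x s) - r * ((Real.cos T * Real.sin T + T) / 2)| ≤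
      4 * Real.pi * K * r ^ 2 := by
    have e : (∫ s in (0 : ℝ)..T, Real.cos s * x s) - r * ((Real.cos T * Real.sin T + T) / 2) =
        ∫ s in (0 : ℝ)..T, Real.cos s * (x s - r * Real.cos s) := by
      have : (fun s => Real.cos s * (x s - r * Real.cos s)) =
          fun s => Real.cos s * x s - r * Real.cos s ^ 2 := by funext s; ring
      rw [this, intervalIntegral.integral_sub, intervalIntegral.integral_const_mul, integral_cos_sq]
      · simp
      · exact (Real.continuous_cos.mul hxc).intervalIntegrable _ _
      · exact Continuous.intervalIntegrable (by fun_prop) _ _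
    rw [e]
    have := intervalIntegral.norm_integral_le_of_norm_le_const (a := 0) (b := T)
      (f := fun s => Real.cos s * (x s - r * Real.cos s)) (C := K * r ^ 2) (fun s hs => by
        rw [uIoc_of_le hT0] at hs
        rw [norm_mul, Real.norm_eq_abs, Real.norm_eq_abs]
        exact (mul_le_of_le_one_left (abs_nonneg _) (Real.abs_cos_le_one s)).trans
          (hx s hs.1.le (hs.2.trans hT4)))
    rw [Real.norm_eq_abs, sub_zero, abs_of_nonneg hT0] at this
    calc _ ≤ K * r ^ 2 * T := this
      _ ≤ K * r ^ 2 * (4 * Real.pi) := by gcongr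
      _ = _ := by ring
  have hQ : |∫ s in (0 : ℝ)..T, Real.sin s * x s| ≤ 4 * Real.pi * (1 + K) := by
    have := intervalIntegral.norm_integral_le_of_norm_le_const (a := 0) (b := T)
      (f := fun s => Real.sin s * x s) (C := 1 + K) (fun s hs => by
        rw [uIoc_of_le hT0] at hs
        rw [norm_mul, Real.norm_eq_abs, Real.norm_eq_abs]
        refine (mul_le_of_le_one_left (abs_nonneg _) (Real.abs_sin_le_one s)).trans ?_
        have h1 := hx s hs.1.le (hs.2.trans hT4)
        have h2 := abs_mul_cos_le hr s
        have h3 : K * r ^ 2 ≤ K := mul_le_of_le_one_right hK (pow_le_one₀ hr hr1)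
        have h4 := abs_sub_abs_le_abs_sub (x s) (r * Real.cos s)
        linarith)
    rw [Real.norm_eq_abs, sub_zero, abs_of_nonneg hT0] at this
    calc _ ≤ (1 + K) * T := this
      _ ≤ (1 + K) * (4 * Real.pi) := by gcongr
      _ = _ := by ring
  set P := ∫ s in (0 : ℝ)..T, Real.cos s * x s
  set Q := ∫ s in (0 : ℝ)..T, Real.sin s * x s
  set m := (Real.cos T * Real.sin T + T) / 2 with hm
  have hcos1 : |Real.cos T - 1| ≤ δ := by
    have := Real.abs_cos_sub_cos_le T (2 * Real.pi)
    rwa [Real.cos_two_pi, ← hδ, abs_of_nonneg hδ0] at this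
  have hcos : |Real.cos T * m - Real.pi| ≤ (1 + Real.pi) * δ := by
    have e : Real.cos T * m - Real.pi = Real.cos T ^ 2 * Real.sin T / 2 + δ * Real.cos T / 2 +
        Real.pi * (Real.cos T - 1) := by rw [hm, hδ]; ring
    have b1 : |Real.cos T ^ 2 * Real.sin T / 2| ≤ δ / 2 := by
      rw [abs_div, abs_mul, abs_of_pos (two_pos : (0 : ℝ) < 2), abs_of_nonneg (sq_nonneg _)]
      gcongr
      exact (mul_le_of_le_one_left (abs_nonneg _) (Real.cos_sq_le_one T)).trans hsin
    have b2 : |δ * Real.cos T / 2| ≤ δ / 2 := by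
      rw [abs_div, abs_mul, abs_of_pos (two_pos : (0 : ℝ) < 2), abs_of_nonneg hδ0]
      gcongr
      exact mul_le_of_le_one_right hδ0 (Real.abs_cos_le_one T)
    have b3 : |Real.pi * (Real.cos T - 1)| ≤ Real.pi * δ := by
      rw [abs_mul, abs_of_pos hπ]
      gcongr
    rw [e]
    linarith [abs_add_three (Real.cos T ^ 2 * Real.sin T / 2) (δ * Real.cos T / 2)
      (Real.pi * (Real.cos T - 1))]
  have e : Real.cos T * P + Real.sin T * Q - Real.pi * r =
      Real.cos T * (P - r * m) + r * (Real.cos T * m - Real.pi) + Real.sin T * Q := by ring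
  have b1 : |Real.cos T * (P - r * m)| ≤ 4 * Real.pi * K * r ^ 2 := by
    rw [abs_mul]
    exact (mul_le_of_le_one_left (abs_nonneg _) (Real.abs_cos_le_one T)).trans hP
  have b2 : |r * (Real.cos T * m - Real.pi)| ≤ (1 + Real.pi) * δ := by
    rw [abs_mul, abs_of_nonneg hr]
    exact (mul_le_of_le_one_left (abs_nonneg _) hr1).trans hcos
  have b3 : |Real.sin T * Q| ≤ δ * (4 * Real.pi * (1 + K)) := by
    rw [abs_mul]
    gcongr
  rw [e]
  linarith [abs_add_three (Real.cos T * (P - r * m)) (r * (Real.cos T * m - Real.pi))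
    (Real.sin T * Q)]

/-- From the expansions of the period and of `z₁'(T)` to those of `z₁(T)` and `χ₁(0)`. -/
theorem offCentral_asymptotics {A : ℝ} (hA : 0 < A) {T d c z : ℝ → ℝ}
    (hT : (fun ε => T ε - 2 * Real.pi * (1 + A * ε ^ 2)) =O[𝓝[>] 0] fun ε => ε ^ 3)
    (hd : (fun ε => d ε - Real.pi * ε) =O[𝓝[>] 0] fun ε => ε ^ 2)
    (hcd : ∀ᶠ ε in 𝓝[>] 0, c ε * Real.sin (T ε) = d ε)
    (hcz : ∀ᶠ ε in 𝓝[>] 0, z ε = c ε * (1 - Real.cos (T ε))) :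
    ((fun ε => c ε - 1 / (2 * A * ε)) =O[𝓝[>] 0] fun _ => (1 : ℝ)) ∧
      (fun ε => z ε - A * Real.pi ^ 2 * ε ^ 3) =O[𝓝[>] 0] fun ε => ε ^ 4 := by
  have hπ := Real.pi_pos
  have hpos : ∀ᶠ ε : ℝ in 𝓝[>] 0, 0 < ε := self_mem_nhdsWithin
  have hsmall : ∀ η : ℝ, 0 < η → ∀ᶠ ε : ℝ in 𝓝[>] 0, ε < η := fun η hη =>
    nhdsWithin_le_nhds (eventually_lt_nhds hη)
  obtain ⟨K, hK, hKT⟩ := hT.exists_pos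
  obtain ⟨L, hL, hLd⟩ := hd.exists_pos
  set B := 2 * Real.pi * A with hB
  have hBpos : 0 < B := by positivity
  have hall : ∀ᶠ ε in 𝓝[>] 0, |Real.sin (T ε) - B * ε ^ 2| ≤ (K + (2 * B) ^ 3) * ε ^ 3 ∧
      |1 - Real.cos (T ε) - B ^ 2 / 2 * ε ^ 4| ≤ (3 * B * K + (2 * B) ^ 4) * ε ^ 5 := by
    filter_upwards [hKT.bound, hpos, hsmall 1 one_pos, hsmall (B / K) (by positivity),
      hsmall (1 / (2 * B)) (by positivity)]
      with ε h1 hε hε1 hεK hεB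
    rw [lt_div_iff₀ hK] at hεK
    rw [lt_div_iff₀ (by positivity)] at hεB
    set δ := T ε - 2 * Real.pi with hδ
    rw [Real.norm_eq_abs, Real.norm_eq_abs, abs_of_pos (pow_pos hε 3),
      show T ε - 2 * Real.pi * (1 + A * ε ^ 2) = δ - B * ε ^ 2 by rw [hδ, hB]; ring] at h1
    have hs : Real.sin (T ε) = Real.sin δ := by rw [hδ, Real.sin_sub_two_pi]
    have hc : Real.cos (T ε) = Real.cos δ := by rw [hδ, Real.cos_sub_two_pi]
    have hK3 : K * ε ^ 3 ≤ B * ε ^ 2 := by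
      have : 0 < ε ^ 2 := by positivity
      nlinarith
    have hδ0 : 0 ≤ δ := by linarith [(abs_le.1 h1).1]
    have hδ2 : δ ≤ 2 * B * ε ^ 2 := by linarith [(abs_le.1 h1).2]
    have hδ1 : δ ≤ 1 := by
      have : 2 * B * ε ^ 2 ≤ ε := by nlinarith
      linarith
    have hδp : ∀ n : ℕ, δ ^ n ≤ (2 * B) ^ n * (ε ^ 2) ^ n := fun n => by
      rw [← mul_pow]; exact pow_le_pow_left₀ hδ0 hδ2 n
    rw [hs, hc]
    constructor
    · have h2 := Real.abs_sub_sin_le δ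
      rw [abs_of_nonneg hδ0, abs_sub_comm] at h2
      have h3 : δ ^ 3 ≤ (2 * B) ^ 3 * ε ^ 3 := by
        refine (hδp 3).trans ?_
        rw [← pow_mul]
        gcongr ?_ * ?_
        exact pow_le_pow_of_le_one hε.le hε1.le (by norm_num)
      have h4 : 0 ≤ δ ^ 3 := by positivity
      linarith [abs_sub_le (Real.sin δ) δ (B * ε ^ 2)]
    · have h2 := Real.cos_bound (x := δ) (by rwa [abs_of_nonneg hδ0])
      rw [abs_of_nonneg hδ0, abs_sub_comm, sub_right_comm] at h2
      have h3 : δ ^ 4 ≤ (2 * B) ^ 4 * ε ^ 5 := by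
        refine (hδp 4).trans ?_
        rw [← pow_mul]
        gcongr ?_ * ?_
        exact pow_le_pow_of_le_one hε.le hε1.le (by norm_num)
      have h4 : 0 ≤ δ ^ 4 := by positivity
      have h5 : |δ ^ 2 / 2 - B ^ 2 / 2 * ε ^ 4| ≤ 3 * B * K * ε ^ 5 := by
        rw [show δ ^ 2 / 2 - B ^ 2 / 2 * ε ^ 4 = (δ - B * ε ^ 2) * ((δ + B * ε ^ 2) / 2) by ring,
          abs_mul, abs_of_nonneg (by positivity : 0 ≤ (δ + B * ε ^ 2) / 2)]
        calc |δ - B * ε ^ 2| * ((δ + B * ε ^ 2) / 2) ≤ (K * ε ^ 3) * (3 * B * ε ^ 2) := by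
              gcongr
              have : 0 < B * ε ^ 2 := by positivity
              linarith
          _ = _ := by ring
      have h6 := abs_sub_le (1 - Real.cos δ) (δ ^ 2 / 2) (B ^ 2 / 2 * ε ^ 4)
      have h7 : 1 - Real.cos δ - δ ^ 2 / 2 = 1 - δ ^ 2 / 2 - Real.cos δ := by ring
      rw [h7] at h6
      rw [sub_right_comm] at h2
      linarith
  set M := K + (2 * B) ^ 3 with hM
  set M₂ := 3 * B * K + (2 * B) ^ 4 with hM₂
  have hMpos : 0 < M := by positivity
  have hM₂pos : 0 < M₂ := by positivity
  set N := 2 * (L + M / (2 * A)) / B with hN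
  have hc : ∀ᶠ ε in 𝓝[>] 0, |c ε - 1 / (2 * A * ε)| ≤ N := by
    filter_upwards [hall, hpos, hLd.bound, hcd, hsmall (B / (2 * M)) (by positivity)]
      with ε ⟨h1, _⟩ hε h3 h4 hεM
    rw [lt_div_iff₀ (by positivity)] at hεM
    rw [Real.norm_eq_abs, Real.norm_eq_abs, abs_of_pos (pow_pos hε 2)] at h3
    have hS : B * ε ^ 2 / 2 ≤ Real.sin (T ε) := by
      have h5 : M * ε ^ 3 ≤ B * ε ^ 2 / 2 := by
        have : 0 < ε ^ 2 := by positivity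
        nlinarith
      linarith [(abs_le.1 h1).1]
    have hS0 : 0 < Real.sin (T ε) := lt_of_lt_of_le (by positivity) hS
    have e : (c ε - 1 / (2 * A * ε)) * Real.sin (T ε) =
        (d ε - Real.pi * ε) - (Real.sin (T ε) - B * ε ^ 2) / (2 * A * ε) := by
      rw [sub_mul, h4, hB]
      field_simp
      ring
    have b : |(Real.sin (T ε) - B * ε ^ 2) / (2 * A * ε)| ≤ M / (2 * A) * ε ^ 2 := by
      rw [abs_div, abs_of_pos (by positivity : 0 < 2 * A * ε), div_le_iff₀ (by positivity)]
      refine h1.trans (le_of_eq ?_)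
      field_simp
    have h6 : |c ε - 1 / (2 * A * ε)| * Real.sin (T ε) ≤ (L + M / (2 * A)) * ε ^ 2 := by
      nth_rw 1 [← abs_of_pos hS0]
      rw [← abs_mul, e]
      refine (abs_sub _ _).trans ?_
      linarith
    have h7 : |c ε - 1 / (2 * A * ε)| * (B * ε ^ 2 / 2) ≤ N * (B * ε ^ 2 / 2) := by
      refine (mul_le_mul_of_nonneg_left hS (abs_nonneg _)).trans (h6.trans (le_of_eq ?_))
      rw [hN]
      field_simp
    exact le_of_mul_le_mul_right h7 (by positivity)
  refine ⟨IsBigO.of_bound N (hc.mono fun ε h => by simpa using h), IsBigO.of_bound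
    (N * (B ^ 2 / 2 + M₂) + M₂ / (2 * A)) ?_⟩
  filter_upwards [hall, hpos, hc, hcz, hsmall 1 one_pos] with ε ⟨_, h1⟩ hε h2 h3 hε1
  rw [Real.norm_eq_abs, Real.norm_eq_abs, abs_of_pos (pow_pos hε 4), h3]
  have e : c ε * (1 - Real.cos (T ε)) - A * Real.pi ^ 2 * ε ^ 3 =
      (c ε - 1 / (2 * A * ε)) * (1 - Real.cos (T ε)) +
        (1 - Real.cos (T ε) - B ^ 2 / 2 * ε ^ 4) / (2 * A * ε) := by
    rw [hB]
    field_simp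
    ring
  have b1 : |(1 - Real.cos (T ε) - B ^ 2 / 2 * ε ^ 4) / (2 * A * ε)| ≤ M₂ / (2 * A) * ε ^ 4 := by
    rw [abs_div, abs_of_pos (by positivity : 0 < 2 * A * ε), div_le_iff₀ (by positivity)]
    refine h1.trans (le_of_eq ?_)
    field_simp
  have b2 : |1 - Real.cos (T ε)| ≤ (B ^ 2 / 2 + M₂) * ε ^ 4 := by
    have h5 : M₂ * ε ^ 5 ≤ M₂ * ε ^ 4 :=
      mul_le_mul_of_nonneg_left (pow_le_pow_of_le_one hε.le hε1.le (by norm_num)) hM₂pos.le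
    have h6 : 0 ≤ 1 - Real.cos (T ε) := by linarith [Real.cos_le_one (T ε)]
    rw [abs_of_nonneg h6]
    linarith [(abs_le.1 h1).2]
  have b3 : |(c ε - 1 / (2 * A * ε)) * (1 - Real.cos (T ε))| ≤
      N * ((B ^ 2 / 2 + M₂) * ε ^ 4) := by
    rw [abs_mul]
    exact mul_le_mul h2 b2 (abs_nonneg _) ((abs_nonneg _).trans h2)
  rw [e]
  refine (abs_add_le _ _).trans ?_
  linarith

/-- The oscillation of chart amplitude `r`, with its particular integral and its off-central
component. -/
theorem IsAmplitudeChart.exists_tangent {V g : ℝ → ℝ} {R C a r : ℝ}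
    (h : IsAmplitudeChart V g R C a) (hr : 0 < r) (hrR : r < R) (hr1 : r ≤ 1)
    (hC : C * r ≤ 1 / 2) (hT : 2 * Real.pi < chartPeriod g r)
    (hT3 : chartPeriod g r < 3 * Real.pi) :
    ∃ x z χ : ℝ → ℝ,
      ((IsNewtonSolution V x ∧ x 0 = g r ∧ deriv x 0 = 0) ∧
        (∀ y : ℝ → ℝ, IsNewtonSolution V y → y 0 = g r → deriv y 0 = 0 → y = x) ∧
        IsOscillation V (chartPeriod g r) x ∧
        2 * Real.pi < chartPeriod g r ∧
        IsParticularIntegral x z ∧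
        (∀ w : ℝ → ℝ, IsParticularIntegral x w → w = z) ∧
        IsOffCentralComponent (chartPeriod g r) x χ ∧
        (∀ w : ℝ → ℝ, IsOffCentralComponent (chartPeriod g r) x w → w = χ) ∧
        χ 0 = z (chartPeriod g r) / (1 - Real.cos (chartPeriod g r))) ∧
      1 - Real.cos (chartPeriod g r) ≠ 0 ∧
      χ 0 * Real.sin (chartPeriod g r) = deriv z (chartPeriod g r) ∧
      |deriv z (chartPeriod g r) - Real.pi * r| ≤ 4 * Real.pi * ((1 + 8 * Real.pi) * C) * r ^ 2 +
        (1 + Real.pi + 4 * Real.pi * (1 + (1 + 8 * Real.pi) * C)) *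
          (chartPeriod g r - 2 * Real.pi) := by
  obtain ⟨x, hx, hx0, hx1, hosc, hreg, hnear⟩ := h.exists_oscillation hr hrR hC
  have hxc : Continuous x := hx.differentiable.continuous
  have hsin : Real.sin (chartPeriod g r) ≠ 0 := by
    rw [← Real.sin_sub_two_pi]
    exact (Real.sin_pos_of_pos_of_lt_pi (by linarith) (by linarith)).ne'
  obtain ⟨z, hz, -⟩ := exists_isParticularIntegral hxc
  obtain ⟨χ, hχ, hχ0, hχs⟩ :=
    hz.exists_isOffCentralComponent hxc hosc.even hosc.period.1.2 hsin
  have hCp := h.const_pos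
  exact ⟨x, z, χ, ⟨⟨hx, hx0, hx1⟩,
    fun y hy hy0 hy1 => hx.eq_of_init hreg hy (hy0.trans hx0.symm) (hy1.trans hx1.symm),
    hosc, hT, hz, fun w hw => hz.unique hw, hχ, fun w hw => hχ.unique hw hsin, hχ0⟩,
    cos_ne_one_of_sin_ne_zero hsin, hχs,
    hz.abs_deriv_sub_le hxc hr.le hr1 (by positivity) hT.le
      (by linarith [Real.pi_pos]) hnear⟩

theorem tendsto_atTop_of_isBigO_sub_inv {A : ℝ} (hA : 0 < A) {f : ℝ → ℝ}
    (hf : (fun ε => f ε - 1 / (2 * A * ε)) =O[𝓝[>] 0] fun _ => (1 : ℝ)) :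
    Tendsto f (𝓝[>] 0) atTop := by
  obtain ⟨N, hN⟩ := hf.bound
  have h1 : Tendsto (fun ε : ℝ => (2 * A)⁻¹ * ε⁻¹ + -N) (𝓝[>] 0) atTop :=
    tendsto_atTop_add_const_right _ _ (tendsto_inv_nhdsGT_zero.const_mul_atTop (by positivity))
  refine tendsto_atTop_mono' _ ?_ h1
  filter_upwards [hN] with ε hε
  rw [norm_one, mul_one, Real.norm_eq_abs] at hε
  have := (abs_le.1 hε).1
  rw [one_div, mul_inv] at this
  linarith

/-- The inverse of a strictly increasing function tends to the left endpoint. -/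
theorem tendsto_rightInverse_nhdsGT {T E : ℝ → ℝ} {ε₀ T₀ T₁ : ℝ} (hε₀ : 0 < ε₀) (hT₁ : T₀ < T₁)
    (hT : StrictMonoOn T (Ioo 0 ε₀)) (hT₀ : ∀ ε ∈ Ioo 0 ε₀, T₀ < T ε)
    (hE : ∀ τ ∈ Ioo T₀ T₁, E τ ∈ Ioo 0 ε₀ ∧ T (E τ) = τ) :
    Tendsto E (𝓝[>] T₀) (𝓝[>] 0) := by
  refine tendsto_nhdsWithin_iff.2 ⟨tendsto_order.2 ⟨fun b hb => ?_, fun b hb => ?_⟩, ?_⟩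
  · filter_upwards [Ioo_mem_nhdsGT hT₁] with τ hτ using hb.trans (hE τ hτ).1.1
  · set η := min b (ε₀ / 2) with hη
    have hηm : η ∈ Ioo 0 ε₀ := ⟨by positivity, (min_le_right _ _).trans_lt (by linarith)⟩
    filter_upwards [Ioo_mem_nhdsGT hT₁, Ioo_mem_nhdsGT (hT₀ η hηm)] with τ hτ hτη
    obtain ⟨h1, h2⟩ := hE τ hτ
    refine lt_of_lt_of_le ((hT.lt_iff_lt h1 hηm).1 ?_) (min_le_left _ _)
    rw [h2]; exact hτη.2
  · filter_upwards [Ioo_mem_nhdsGT hT₁] with τ hτ using (hE τ hτ).1.1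

theorem mainTheorem3 (V : ℝ → ℝ) (hV : AnalyticAt ℝ V 0)
    (hV1 : deriv V 0 = 0) (hV2 : iteratedDeriv 2 V 0 = 1)
    (hA : 0 < periodCoefficient V) :
    ∃ ε₀ : ℝ, 0 < ε₀ ∧ ∃ (x z χ : ℝ → ℝ → ℝ) (T : ℝ → ℝ),
      -- the objects attached to the oscillation of amplitude `ε`
      (∀ ε ∈ Ioo 0 ε₀,
        (IsNewtonSolution V (x ε) ∧ x ε 0 = ε ∧ deriv (x ε) 0 = 0) ∧
        (∀ y : ℝ → ℝ, IsNewtonSolution V y → y 0 = ε → deriv y 0 = 0 → y = x ε) ∧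
        IsOscillation V (T ε) (x ε) ∧
        2 * Real.pi < T ε ∧
        IsParticularIntegral (x ε) (z ε) ∧
        (∀ w : ℝ → ℝ, IsParticularIntegral (x ε) w → w = z ε) ∧
        IsOffCentralComponent (T ε) (x ε) (χ ε) ∧
        (∀ w : ℝ → ℝ, IsOffCentralComponent (T ε) (x ε) w → w = χ ε) ∧
        χ ε 0 = z ε (T ε) / (1 - Real.cos (T ε))) ∧
      -- asymptotics for small amplitude
      ((fun ε => T ε - 2 * Real.pi * (1 + periodCoefficient V * ε ^ 2))
        =O[𝓝[>] 0] fun ε => ε ^ 3) ∧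
      ((fun ε => z ε (T ε) - periodCoefficient V * Real.pi ^ 2 * ε ^ 3)
        =O[𝓝[>] 0] fun ε => ε ^ 4) ∧
      ((fun ε => χ ε 0 - 1 / (2 * periodCoefficient V * ε))
        =O[𝓝[>] 0] fun _ => (1 : ℝ)) ∧
      -- the period parametrizes the small oscillations, and `χ₁(0) → +∞` as `T → 2π⁺`
      (∃ T₁ : ℝ, 2 * Real.pi < T₁ ∧ StrictMonoOn T (Ioo 0 ε₀) ∧
        ∃ E : ℝ → ℝ,
          (∀ ε ∈ Ioo 0 ε₀, T ε ∈ Ioo (2 * Real.pi) T₁) ∧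
          (∀ τ ∈ Ioo (2 * Real.pi) T₁, E τ ∈ Ioo 0 ε₀ ∧ T (E τ) = τ) ∧
          Tendsto (fun τ => χ (E τ) 0) (𝓝[>] (2 * Real.pi)) atTop) ∧
      -- in particular when the oscillation of period `τ` is unique without restriction of amplitude
      (∀ X C : ℝ → ℝ → ℝ,
        (∀ᶠ τ in 𝓝[>] (2 * Real.pi), IsOscillation V τ (X τ) ∧
          (∀ y : ℝ → ℝ, IsOscillation V τ y → y = X τ) ∧
          IsOffCentralComponent τ (X τ) (C τ)) →
        Tendsto (fun τ => C τ 0) (𝓝[>] (2 * Real.pi)) atTop) := by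
  have hV2' : deriv (deriv V) 0 = 1 := by
    rwa [iteratedDeriv_succ, iteratedDeriv_one] at hV2
  obtain ⟨g, R, C, a, h⟩ := exists_isAmplitudeChart hV hV1 hV2'
  set A := periodCoefficient V with hAdef
  have hπ := Real.pi_pos
  have hR := h.radius_pos
  have hC := h.const_pos
  obtain ⟨r₀, hr₀, hr₀R, hr₀1, hr₀C, hr₀A, hr₀A'⟩ : ∃ r₀ : ℝ, 0 < r₀ ∧ r₀ < R ∧ r₀ ≤ 1 ∧
      C * r₀ ≤ 1 / 2 ∧ C * r₀ < A ∧ A * r₀ ≤ 1 / 8 := by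
    have hsmall : ∀ b c : ℝ, 0 < c → ∀ᶠ r in 𝓝[>] (0 : ℝ), b * r < c := fun b c hc => by
      have : Tendsto (fun r : ℝ => b * r) (𝓝[>] 0) (𝓝 0) := by
        simpa using ((continuous_const_mul b).tendsto 0).mono_left nhdsWithin_le_nhds
      exact this.eventually_lt_const hc
    obtain ⟨r, ⟨⟨h1, h2⟩, h3, h4⟩, h5, h6⟩ := (((hsmall 1 R hR).and (hsmall 1 1 one_pos)).and
      ((hsmall C (1 / 2) (by norm_num)).and (hsmall C A hA))).and
      ((hsmall A (1 / 8) (by norm_num)).and self_mem_nhdsWithin) |>.exists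
    exact ⟨r, h6, by linarith, by linarith, h3.le, h4, h5.le⟩
  set P := chartPeriod g with hP
  have hP0 : P 0 = 2 * Real.pi := h.chartPeriod_zero
  have hPmono : StrictMonoOn P (Icc 0 r₀) := h.strictMonoOn_chartPeriod hr₀R hr₀A
  have hPcont : ContinuousOn P (Icc 0 r₀) := h.continuousOn_chartPeriod hr₀R
  have hgmono : StrictMonoOn g (Icc 0 r₀) := h.strictMonoOn.mono fun r hr =>
    ⟨by linarith [hr.1], by linarith [hr.2]⟩
  have hgcont : ContinuousOn g (Icc 0 r₀) := fun r hr =>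
    (h.hasDerivAt r (by rw [abs_of_nonneg hr.1]; linarith [hr.2])).continuousAt.continuousWithinAt
  have h0mem : (0 : ℝ) ∈ Icc 0 r₀ := ⟨le_rfl, hr₀.le⟩
  have hr₀mem : r₀ ∈ Icc 0 r₀ := ⟨hr₀.le, le_rfl⟩
  have hε₀ : 0 < g r₀ := by simpa [h.map_zero] using hgmono h0mem hr₀mem hr₀
  have hPr : ∀ r ∈ Icc 0 r₀, |P r - 2 * Real.pi - 2 * Real.pi * A * r ^ 2| ≤
      2 * Real.pi * C * r ^ 3 := fun r hr => by
    have := h.abs_chartPeriod_sub_le hr.1 le_rfl le_rfl hr.1 (hr.2.trans_lt hr₀R)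
    rw [h.chartPeriod_zero, sub_zero, abs_of_nonneg hr.1] at this
    convert! this using 1
    · norm_num [hP, hAdef]
    · ring
  have hPup : ∀ r ∈ Icc 0 r₀, P r - 2 * Real.pi ≤ 4 * Real.pi * A * r ^ 2 := fun r hr => by
    have h1 := (abs_le.1 (hPr r hr)).2
    have h2 : C * r ≤ A := (mul_le_mul_of_nonneg_left hr.2 hC.le).trans hr₀A.le
    have h3 : 0 ≤ 2 * Real.pi * r ^ 2 * (A - C * r) :=
      mul_nonneg (by positivity) (by linarith)
    nlinarith
  have hPlow : ∀ r ∈ Ioo 0 r₀, 2 * Real.pi < P r := fun r hr => by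
    rw [← hP0]; exact hPmono h0mem (Ioo_subset_Icc_self hr) hr.1
  have hP3 : ∀ r ∈ Ioo 0 r₀, P r < 3 * Real.pi := fun r hr => by
    have h1 := hPup r (Ioo_subset_Icc_self hr)
    have h2 : A * r ^ 2 ≤ 1 / 8 := by
      calc A * r ^ 2 ≤ A * r := by
            gcongr
            exact pow_le_of_le_one hr.1.le (by linarith [hr.2]) two_ne_zero
        _ ≤ A * r₀ := by gcongr; exact hr.2.le
        _ ≤ 1 / 8 := hr₀A'
    nlinarith
  have hinv : ∀ ε, ∃ r, ε ∈ Ioo 0 (g r₀) → r ∈ Ioo 0 r₀ ∧ g r = ε := fun ε => by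
    by_cases hε : ε ∈ Ioo 0 (g r₀)
    · obtain ⟨r, hr, hgr⟩ := intermediate_value_Ioo hr₀.le hgcont (by rwa [h.map_zero])
      exact ⟨r, fun _ => ⟨hr, hgr⟩⟩
    · exact ⟨0, fun hh => absurd hh hε⟩
  choose k hk using hinv
  have hfam : ∀ ε, ∃ x z χ : ℝ → ℝ, ε ∈ Ioo 0 (g r₀) → _ := fun ε => by
    by_cases hε : ε ∈ Ioo 0 (g r₀)
    · have hkε := (hk ε hε).1
      obtain ⟨x, z, χ, hh⟩ := h.exists_tangent hkε.1 (hkε.2.trans hr₀R) (by linarith [hkε.2])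
        ((mul_le_mul_of_nonneg_left hkε.2.le hC.le).trans hr₀C) (hPlow _ hkε) (hP3 _ hkε)
      exact ⟨x, z, χ, fun _ => hh⟩
    · exact ⟨0, 0, 0, fun hh => absurd hh hε⟩
  choose x z χ hxzχ using hfam
  have hnear : ∀ ε ∈ Ioo 0 (g r₀), |k ε - ε| ≤ 4 * C * ε ^ 2 ∧ k ε ≤ 2 * ε := fun ε hε => by
    obtain ⟨hkm, hkg⟩ := hk ε hε
    have h1 := h.sub_self (k ε) (by rw [abs_of_pos hkm.1]; exact hkm.2.trans hr₀R)
    rw [hkg, abs_sub_comm] at h1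
    have h2 : C * k ε ^ 2 ≤ k ε / 2 := by
      have : C * k ε ≤ 1 / 2 := (mul_le_mul_of_nonneg_left hkm.2.le hC.le).trans hr₀C
      nlinarith [hkm.1]
    have h3 : k ε ≤ 2 * ε := by linarith [(abs_le.1 h1).2]
    refine ⟨h1.trans ?_, h3⟩
    have : k ε ^ 2 ≤ (2 * ε) ^ 2 := pow_le_pow_left₀ hkm.1.le h3 2
    nlinarith
  have hev : ∀ᶠ ε in 𝓝[>] 0, ε ∈ Ioo 0 (g r₀) := Ioo_mem_nhdsGT hε₀
  have hTasym : (fun ε => P (k ε) - 2 * Real.pi * (1 + A * ε ^ 2)) =O[𝓝[>] 0] fun ε => ε ^ 3 := by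
    refine IsBigO.of_bound (16 * Real.pi * C + 24 * Real.pi * A * C) ?_
    filter_upwards [hev] with ε hε
    obtain ⟨hkm, hkg⟩ := hk ε hε
    obtain ⟨h1, h2⟩ := hnear ε hε
    have hεp := hε.1
    rw [Real.norm_eq_abs, Real.norm_eq_abs, abs_of_pos (pow_pos hεp 3)]
    have e : P (k ε) - 2 * Real.pi * (1 + A * ε ^ 2) =
        (P (k ε) - 2 * Real.pi - 2 * Real.pi * A * k ε ^ 2) +
          2 * Real.pi * A * ((k ε + ε) * (k ε - ε)) := by ring
    have b1 : 2 * Real.pi * C * k ε ^ 3 ≤ 2 * Real.pi * C * (2 * ε) ^ 3 := by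
      gcongr
      exact hkm.1.le
    have b2 : |2 * Real.pi * A * ((k ε + ε) * (k ε - ε))| ≤
        2 * Real.pi * A * ((3 * ε) * (4 * C * ε ^ 2)) := by
      have hkp := hkm.1
      rw [abs_mul, abs_mul (k ε + ε), abs_of_pos (by positivity : 0 < 2 * Real.pi * A),
        abs_of_pos (by positivity : 0 < k ε + ε)]
      gcongr
      linarith
    rw [e]
    refine (abs_add_le _ _).trans ?_
    linarith [hPr _ (Ioo_subset_Icc_self hkm)]
  have hdasym : (fun ε => deriv (z ε) (P (k ε)) - Real.pi * ε) =O[𝓝[>] 0] fun ε => ε ^ 2 := by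
    set K := (1 + 8 * Real.pi) * C with hKdef
    have hK : 0 < K := by positivity
    refine IsBigO.of_bound (4 * Real.pi * K * 4 +
      (1 + Real.pi + 4 * Real.pi * (1 + K)) * (16 * Real.pi * A) + Real.pi * (4 * C)) ?_
    filter_upwards [hev] with ε hε
    obtain ⟨hkm, hkg⟩ := hk ε hε
    obtain ⟨h1, h2⟩ := hnear ε hε
    rw [Real.norm_eq_abs, Real.norm_eq_abs, abs_of_pos (pow_pos hε.1 2)]
    have h3 := (hxzχ ε hε).2.2.2
    have hsq : k ε ^ 2 ≤ 4 * ε ^ 2 := by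
      have := pow_le_pow_left₀ hkm.1.le h2 2
      linarith
    have h4 : P (k ε) - 2 * Real.pi ≤ 16 * Real.pi * A * ε ^ 2 := by
      have h5 : 4 * Real.pi * A * k ε ^ 2 ≤ 4 * Real.pi * A * (4 * ε ^ 2) := by gcongr
      linarith [hPup _ (Ioo_subset_Icc_self hkm)]
    have h5 : 4 * Real.pi * K * k ε ^ 2 ≤ 4 * Real.pi * K * (4 * ε ^ 2) := by gcongr
    have h6 : (1 + Real.pi + 4 * Real.pi * (1 + K)) * (P (k ε) - 2 * Real.pi) ≤
        (1 + Real.pi + 4 * Real.pi * (1 + K)) * (16 * Real.pi * A * ε ^ 2) := by gcongr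
    have h7 : |Real.pi * k ε - Real.pi * ε| ≤ Real.pi * (4 * C * ε ^ 2) := by
      rw [← mul_sub, abs_mul, abs_of_pos hπ]
      gcongr
    refine (abs_sub_le _ (Real.pi * k ε) _).trans ?_
    linarith
  obtain ⟨hcasym, hzasym⟩ := offCentral_asymptotics hA (c := fun ε => χ ε 0)
    (z := fun ε => z ε (P (k ε))) hTasym hdasym
    (hev.mono fun ε hε => (hxzχ ε hε).2.2.1)
    (hev.mono fun ε hε => by
      obtain ⟨⟨-, -, -, -, -, -, -, -, h1⟩, h2, -⟩ := hxzχ ε hε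
      rw [h1, div_mul_cancel₀ _ h2])
  have hmain : ∀ ε ∈ Ioo 0 (g r₀),
        (IsNewtonSolution V (x ε) ∧ x ε 0 = ε ∧ deriv (x ε) 0 = 0) ∧
        (∀ y : ℝ → ℝ, IsNewtonSolution V y → y 0 = ε → deriv y 0 = 0 → y = x ε) ∧
        IsOscillation V (P (k ε)) (x ε) ∧
        2 * Real.pi < P (k ε) ∧
        IsParticularIntegral (x ε) (z ε) ∧
        (∀ w : ℝ → ℝ, IsParticularIntegral (x ε) w → w = z ε) ∧
        IsOffCentralComponent (P (k ε)) (x ε) (χ ε) ∧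
        (∀ w : ℝ → ℝ, IsOffCentralComponent (P (k ε)) (x ε) w → w = χ ε) ∧
        χ ε 0 = z ε (P (k ε)) / (1 - Real.cos (P (k ε))) := fun ε hε => by
    have := (hxzχ ε hε).1
    rwa [(hk ε hε).2] at this
  have hTmono : StrictMonoOn (fun ε => P (k ε)) (Ioo 0 (g r₀)) := fun ε hε η hη hlt => by
    obtain ⟨hkε, hgε⟩ := hk ε hε
    obtain ⟨hkη, hgη⟩ := hk η hη
    refine hPmono (Ioo_subset_Icc_self hkε) (Ioo_subset_Icc_self hkη) ?_
    rw [← hgmono.lt_iff_lt (Ioo_subset_Icc_self hkε) (Ioo_subset_Icc_self hkη), hgε, hgη]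
    exact hlt
  have hE : ∀ τ, ∃ ε, τ ∈ Ioo (2 * Real.pi) (P r₀) → ε ∈ Ioo 0 (g r₀) ∧ P (k ε) = τ := fun τ => by
    by_cases hτ : τ ∈ Ioo (2 * Real.pi) (P r₀)
    · obtain ⟨r, hr, hPr⟩ := intermediate_value_Ioo hr₀.le hPcont (by rwa [hP0])
      have hrI := Ioo_subset_Icc_self hr
      have hgr : g r ∈ Ioo 0 (g r₀) :=
        ⟨by simpa [h.map_zero] using hgmono h0mem hrI hr.1, hgmono hrI hr₀mem hr.2⟩
      obtain ⟨h1, h2⟩ := hk _ hgr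
      refine ⟨g r, fun _ => ⟨hgr, ?_⟩⟩
      rw [hgmono.injOn (Ioo_subset_Icc_self h1) hrI h2, hPr]
    · exact ⟨0, fun hh => absurd hh hτ⟩
  choose E hE using hE
  have hT₁ : 2 * Real.pi < P r₀ := by rw [← hP0]; exact hPmono h0mem hr₀mem hr₀
  have hEtend : Tendsto (fun τ => χ (E τ) 0) (𝓝[>] (2 * Real.pi)) atTop :=
    (tendsto_atTop_of_isBigO_sub_inv hA hcasym).comp
      (tendsto_rightInverse_nhdsGT hε₀ hT₁ hTmono (fun ε hε => hPlow _ (hk ε hε).1) hE)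
  refine ⟨g r₀, hε₀, x, z, χ, fun ε => P (k ε), hmain, hTasym, hzasym, hcasym,
    ⟨P r₀, hT₁, hTmono, E, fun ε hε => ⟨hPlow _ (hk ε hε).1, ?_⟩, hE, hEtend⟩, fun X D hXD => ?_⟩
  · exact hPmono (Ioo_subset_Icc_self (hk ε hε).1) hr₀mem (hk ε hε).1.2
  · refine hEtend.congr' ?_
    filter_upwards [hXD, Ioo_mem_nhdsGT hT₁] with τ ⟨_, huniq, hD⟩ hτ
    obtain ⟨hEm, hEτ⟩ := hE τ hτ
    obtain ⟨-, -, hosc, -, -, -, -, hχu, -⟩ := hmain _ hEm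
    rw [hEτ] at hosc hχu
    rw [← huniq _ hosc] at hD
    rw [hχu _ hD]
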